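/- **Setting.** Let $n,p\ge 0$ and $k\ge 1$ be integers and let $\Omega\subseteq\mathbb R^n$. Let $\square^n=[0,1]^n$. A $p$-face $\tau$ of $\square^n$ is obtained by letting $p$ coordinates $x_{i_1},\dots,x_{i_p}$ ($i_1<\dots<i_p$) vary in $[0,1]$ and fixing each other coordinate $x_i$ at a value $y_i\in\{0,1\}$. For a multi-index $\mathbf m=(m_1,\dots,m_n)$ with $0\le m_i\le k-1$, the corresponding $k$th order small $p$-cube of $\square^n$ is $\frac1k(\mathbf m+\tau)$, and the corresponding $k$th order cubical $p$-form is $$\Big(\prod_{i=1}^n x_i^{m_i}(1-x_i)^{k-1-m_i}\Big)\Big(\prod_{i\notin\{i_1,\dots,i_p\}}x_i^{y_i}(1-x_i)^{1-y_i}\Big)\,dx_{i_1}\wedge\dots\wedge dx_{i_p}.$$ A *cubical mesh* $K$ in $\Omega$ is a mesh whose $n$-cells $\sigma\subseteq\Omega$ are parallelotopes $\sigma=\phi_\sigma(\square^n)$, with $\phi_\sigma$ an affine bijection, such that any two $n$-cells that meet do so in a common face; its other cells are the faces of its $n$-cells. The $k$th order small $p$-cubes of $\sigma$ are the images under $\phi_\sigma$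 of those of $\square^n$, and $Q_k^p(\sigma)$ is the span of the pullbacks by $\phi_\sigma^{-1}$ of the $k$th order cubical $p$-forms. For a continuous $p$-form $\omega$ on $\Omega$, the interpolant $\mathcal W\mathcal C_k\omega$ is the form, given on each $n$-cell $\sigma$ by an element of $Q_k^p(\sigma)$, such that $$\int_\upsilon \mathcal W\mathcal C_k\omega=\int_\upsilon\omega\qquad\text{for all $k$th order small $p$-cubes $\upsilon$ of all $n$-cells $\sigma$ of $K$.}$$ Let $\Theta(\sigma)=|\sigma|/\operatorname{diam}(\sigma)^n$ denote the fullness of an $n$-cell $\sigma$, and let $|\cdot|$ be the comass norm of $p$-covectors. **Theorem.** Let $\omega$ be a $p$-form that is smooth on an open set containing $\Omega$ and whose derivatives of order $k$ are bounded on $\Omega$ (which is automatic if $\Omega$ is compact). There is a constant $C_{\omega,k}$ such that, whenever $h>0$, $C_\Theta>0$, and $K$ is a cubical mesh in $\Omega$ with $\operatorname{diam}(\sigma)\le h$ and $\Theta(\sigma)\ge C_\Theta$ for all $n$-cells $\sigma$ of $K$, the interpolant $\mathcal W\mathcal C_k\omega$ exists, is unique, and satisfies $$|\mathcal W\mathcal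 C_k\omega(x)-\omega(x)|\le\frac{C_{\omega,k}}{C_\Theta^{\,p}}\,h^k\qquad\text{for all $x\in\sigma$ and all $n$-cells $\sigma$ of $K$.}$$ -/

import Mathlib

open MeasureTheory Set

/-- Differential `p`-forms on `ℝⁿ` (Euclidean). The norm on the values is the comass norm
`sup {|α (v₁, …, v_p)| : |v_i| ≤ 1}`. -/
abbrev DForm (n p : ℕ) : Type :=
  EuclideanSpace ℝ (Fin n) → (EuclideanSpace ℝ (Fin n)) [⋀^Fin p]→L[ℝ] ℝ

namespace CubicalForms

variable {n p : ℕ}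

/-- The pullback `f^* ω`. -/
noncomputable def pullback (f : EuclideanSpace ℝ (Fin n) → EuclideanSpace ℝ (Fin n))
    (ω : DForm n p) : DForm n p :=
  fun x => (ω (f x)).compContinuousLinearMap (fderiv ℝ f x)

/-- The integral of a `p`-form over the singular `p`-cube `γ : [0,1]^p → ℝⁿ`, which carries the
orientation given by the order of the `p` parameters. -/
noncomputable def integralOver (γ : (Fin p → ℝ) → EuclideanSpace ℝ (Fin n))
    (ω : DForm n p) : ℝ :=
  ∫ t in Icc (0 : Fin p → ℝ) 1, ω (γ t) (fun j => fderiv ℝ γ t (Pi.single j 1))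

/-- The determinant of `p` vectors of `ℝ^p`, as a continuous alternating map. -/
noncomputable def detForm (p : ℕ) : (Fin p → ℝ) [⋀^Fin p]→L[ℝ] ℝ :=
  { (Matrix.detRowAlternating : (Fin p → ℝ) [⋀^Fin p]→ₗ[ℝ] ℝ) with
    cont := by
      change Continuous fun v : Fin p → Fin p → ℝ => Matrix.det (Matrix.of v)
      exact Continuous.matrix_det continuous_id }

/-- The constant form `dx_{i₁} ∧ ⋯ ∧ dx_{i_p}`, where `I j = i_j`; its value at `(v₁, …, v_p)` is
`det (v_a)_{i_b}`. -/
noncomputable def dx (I : Fin p ↪o Fin n) : (EuclideanSpace ℝ (Fin n)) [⋀^Fin p]→L[ℝ] ℝ :=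
  (detForm p).compContinuousLinearMap
    (ContinuousLinearMap.pi fun j => EuclideanSpace.proj (I j))

/-- The unit cube `□ⁿ = [0,1]ⁿ`. -/
def unitCube (n : ℕ) : Set (EuclideanSpace ℝ (Fin n)) := {x | ∀ i, x i ∈ Icc (0 : ℝ) 1}

/-- A `p`-face of `□ⁿ`: the coordinates `dir 0 < ⋯ < dir (p - 1)` run through `[0,1]` on the face,
and every other coordinate `i` has the constant value `val i ∈ {0, 1}`. (The value of `val` on the
free coordinates is normalised to `0`, so that a face has only one description.) -/
structure Face (n p : ℕ) where
  dir : Fin p ↪o Fin n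
  val : Fin n → Fin 2
  val_dir : ∀ j, val (dir j) = 0

/-- The set of points of a face. -/
def Face.carrier (τ : Face n p) : Set (EuclideanSpace ℝ (Fin n)) :=
  {x ∈ unitCube n | ∀ i ∉ Set.range τ.dir, x i = ((τ.val i : ℕ) : ℝ)}

/-- The standard parametrisation `[0,1]^p → τ`: the coordinate `dir j` is `t j` and the remaining
coordinates are `val`. -/
noncomputable def Face.param (τ : Face n p) (t : Fin p → ℝ) : EuclideanSpace ℝ (Fin n) :=
  WithLp.toLp 2 fun i => ((τ.val i : ℕ) : ℝ) + ∑ j, if τ.dir j = i then t j else 0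

/-- The map `x ↦ (m + x) / k` of `□ⁿ` into itself, for a multi-index `m` with `0 ≤ m_i ≤ k - 1`. -/
noncomputable def smallMap (k : ℕ) (m : Fin n → Fin k) (x : EuclideanSpace ℝ (Fin n)) :
    EuclideanSpace ℝ (Fin n) :=
  WithLp.toLp 2 fun i => (((m i : ℕ) : ℝ) + x i) / (k : ℝ)

/-- The lowest order cubical form of a face `τ` of `□ⁿ`,
`(∏_{i not free} x_i ^ y_i (1 - x_i) ^ (1 - y_i)) dx_{i₁} ∧ ⋯ ∧ dx_{i_p}` with `y = τ.val`. -/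
noncomputable def lowestForm (τ : Face n p) : DForm n p := fun x =>
  (∏ i ∈ (Finset.univ.image τ.dir)ᶜ,
    x i ^ (τ.val i : ℕ) * (1 - x i) ^ (1 - (τ.val i : ℕ))) • dx τ.dir

/-- The `k`th order cubical form of the small cube of `□ⁿ` given by `m` and `τ`. -/
noncomputable def cubicalForm (k : ℕ) (m : Fin n → Fin k) (τ : Face n p) : DForm n p := fun x =>
  (∏ i, x i ^ (m i : ℕ) * (1 - x i) ^ (k - 1 - (m i : ℕ))) • lowestForm τ x

/-- The oriented `k`th order small `p`-cube of `σ = φ(□ⁿ)` given by `m` and `τ`: it is the set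
`φ(smallMap k m (τ))`, parametrised through `τ`. -/
noncomputable def smallCube (φ : EuclideanSpace ℝ (Fin n) ≃ᵃ[ℝ] EuclideanSpace ℝ (Fin n)) (k : ℕ)
    (m : Fin n → Fin k) (τ : Face n p) : (Fin p → ℝ) → EuclideanSpace ℝ (Fin n) :=
  fun t => φ (smallMap k m (τ.param t))

/-- The space of `k`th order cubical `p`-forms of the parallelotope `φ(□ⁿ)`: the span of the
pullbacks through `φ⁻¹` of the `k`th order cubical forms of `□ⁿ`. -/
noncomputable def cellSpace (φ : EuclideanSpace ℝ (Fin n) ≃ᵃ[ℝ] EuclideanSpace ℝ (Fin n))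
    (k p : ℕ) : Submodule ℝ (DForm n p) :=
  Submodule.span ℝ
    {η | ∃ (m : Fin n → Fin k) (τ : Face n p), η = pullback φ.symm (cubicalForm k m τ)}

/-- A cubical mesh in `Ω ⊆ ℝⁿ`, given by its `n`-cells: each of them is a parallelotope contained in
`Ω`, the image of `□ⁿ` under an affine bijection, and two of them that meet do so in a common face
(of some dimension). The other cells of the mesh are the faces of the `n`-cells. -/
structure CubicalMesh (n : ℕ) (Ω : Set (EuclideanSpace ℝ (Fin n))) where
  cells : Set (Set (EuclideanSpace ℝ (Fin n)))
  chart : cells → (EuclideanSpace ℝ (Fin n) ≃ᵃ[ℝ] EuclideanSpace ℝ (Fin n))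
  chart_image : ∀ σ : cells, chart σ '' unitCube n = σ
  subset : ∀ σ : cells, (σ : Set (EuclideanSpace ℝ (Fin n))) ⊆ Ω
  inter : ∀ σ σ' : cells, ((σ : Set (EuclideanSpace ℝ (Fin n))) ∩ σ').Nonempty →
    ∃ (q : ℕ) (τ τ' : Face n q),
      (σ : Set (EuclideanSpace ℝ (Fin n))) ∩ σ' = chart σ '' τ.carrier ∧
      (σ : Set (EuclideanSpace ℝ (Fin n))) ∩ σ' = chart σ' '' τ'.carrier

/-- The fullness `|σ| / diam(σ)ⁿ` of an `n`-cell. -/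
noncomputable def fullness (σ : Set (EuclideanSpace ℝ (Fin n))) : ℝ :=
  (volume σ).toReal / Metric.diam σ ^ n

variable {Ω : Set (EuclideanSpace ℝ (Fin n))}

/-- The oriented `p`-cells of the refinement `K_k`: the `k`th order small `p`-cubes of the
`n`-cells of `K`. -/
def CubicalMesh.smallCubes (K : CubicalMesh n Ω) (k p : ℕ) :
    Set ((Fin p → ℝ) → EuclideanSpace ℝ (Fin n)) :=
  {γ | ∃ (σ : K.cells) (m : Fin n → Fin k) (τ : Face n p), γ = smallCube (K.chart σ) k m τ}

/-- The de Rham map `𝒞_k` of the refinement `K_k`. -/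
noncomputable def CubicalMesh.deRham (K : CubicalMesh n Ω) (k : ℕ) (ω : DForm n p) :
    K.smallCubes k p → ℝ :=
  fun γ => integralOver γ.1 ω

/-- `η`, a form on each `n`-cell, interpolates the cochain `X`: on each `n`-cell `σ` it is a `k`th
order cubical form, and its integral over each small `p`-cube of `σ` is the value of `X` there. -/
def CubicalMesh.IsInterpolant (K : CubicalMesh n Ω) (k : ℕ) (X : K.smallCubes k p → ℝ)
    (η : K.cells → DForm n p) : Prop :=
  ∀ σ : K.cells, η σ ∈ cellSpace (K.chart σ) k p ∧
    ∀ (m : Fin n → Fin k) (τ : Face n p),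
      integralOver (smallCube (K.chart σ) k m τ) (η σ) =
        X ⟨smallCube (K.chart σ) k m τ, σ, m, τ, rfl⟩

/-- The interpolation operator `𝒲`: the form that interpolates `X` (some arbitrary form if there is
none; `K.interpolate k X σ` is the restriction to the `n`-cell `σ`). -/
noncomputable def CubicalMesh.interpolate (K : CubicalMesh n Ω) (k : ℕ)
    (X : K.smallCubes k p → ℝ) : K.cells → DForm n p :=
  Classical.epsilon (K.IsInterpolant k X)

end CubicalForms

/-!
Pulled back to `□ⁿ` and read in the frame of edge vectors of a cell, a form becomes a family of
scalar coefficients, one for each direction `dx I`, and `I` interacts only with the small cubes in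
the directions `I`. The problem thus splits into scalar ones: find a polynomial of given multidegree
(`k - 1` in the directions of `I` and `k` in the others) with prescribed means over a grid of small
cubes. There are as many cubes as the dimension of that space, and products of Lagrange
interpolation polynomials and of derivatives of such polynomials solve it, so the solution exists
and is unique.

Polynomials of total degree less than `k` are reproduced, so the error in each coefficient is at
most a constant times the Taylor remainder, which is `O(d ^ k * d ^ p)` for a cell of diameter `d`
because `ω` is evaluated on `p` edge vectors. Returning to the comass norm costs `‖A⁻¹‖ ^ p`, where
`A` is the linear part of the chart. Cramer's rule and Hadamard's inequality give
`d * ‖A⁻¹‖ ≤ n / Θ`, whence the factor `Θ⁻ᵖ`.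
-/

namespace CubicalForms

variable {n p : ℕ}

local notation "ℝ^" n:max => EuclideanSpace ℝ (Fin n)

section Taylor

variable {E F : Type*} [NormedAddCommGroup E] [NormedSpace ℝ E] [NormedAddCommGroup F]
  [NormedSpace ℝ F] [CompleteSpace F]

theorem norm_sub_taylorSum_le {f : E → F} {k : ℕ} {x v : E} {B : ℝ}
    (hf : ∀ t ∈ Icc (0 : ℝ) 1, ContDiffAt ℝ k f (x + t • v))
    (hB : ∀ t ∈ Icc (0 : ℝ) 1, ‖iteratedFDeriv ℝ k f (x + t • v) fun _ => v‖ ≤ B) :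
    ‖f (x + v) - ∑ j ∈ Finset.range k, (j.factorial : ℝ)⁻¹ • iteratedFDeriv ℝ j f x fun _ => v‖ ≤
      B := by
  cases k with
  | zero => simpa using hB 1 (by simp)
  | succ k =>
    have hf' : ∀ t ∈ Icc (0 : ℝ) 1, ContDiffAt ℝ (k + 1) f (x + t • v) := by exact_mod_cast hf
    rw [map_add_eq_sum_add_integral_iteratedFDeriv hf', add_sub_cancel_left,
      norm_smul, norm_inv, Real.norm_natCast]
    have hint : ‖∫ t in (0 : ℝ)..1,
        (1 - t) ^ k • iteratedFDeriv ℝ (k + 1) f (x + t • v) fun _ => v‖ ≤ B * |(1 : ℝ) - 0| := by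
      refine intervalIntegral.norm_integral_le_of_norm_le_const fun t ht => ?_
      rw [uIoc_of_le zero_le_one] at ht
      rw [norm_smul, norm_pow, Real.norm_of_nonneg (by linarith [ht.2])]
      have hpow : (1 - t) ^ k ≤ 1 := pow_le_one₀ (by linarith [ht.2]) (by linarith [ht.1])
      exact (mul_le_of_le_one_left (norm_nonneg _) hpow).trans (hB t (Ioc_subset_Icc_self ht))
    rw [sub_zero, abs_one, mul_one] at hint
    exact (mul_le_of_le_one_left (norm_nonneg _)
      (inv_le_one_of_one_le₀ (by exact_mod_cast k.factorial_pos))).trans hint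

end Taylor

section Cramer

variable {ι R M : Type*} [Fintype ι] [DecidableEq ι] [CommRing R] [AddCommGroup M] [Module R M]

theorem det_update_self (b : Module.Basis ι R M) (i : ι) (x : M) :
    b.det (Function.update b i x) = b.repr x i := by
  rw [b.det_apply, b.toMatrix_update, b.toMatrix_self, ← Matrix.cramer_apply, Matrix.cramer_one,
    Module.End.one_apply]

theorem repr_symm_apply_mul_det (b : Module.Basis ι R M) (A : M ≃ₗ[R] M) (w : M) (i : ι) :
    b.repr (A.symm w) i * LinearMap.det (A : M →ₗ[R] M) =
      b.det (Function.update (A ∘ b) i w) := by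
  rw [← det_update_self, mul_comm, ← Module.Basis.det_comp]
  congr 1
  ext j
  by_cases hj : j = i <;> simp [hj]

end Cramer

section Hadamard

variable {E : Type*} [NormedAddCommGroup E] [InnerProductSpace ℝ E]

theorem abs_det_le_prod_norm (b : OrthonormalBasis (Fin n) ℝ E) (v : Fin n → E) :
    |b.toBasis.det v| ≤ ∏ i, ‖v i‖ := by
  have : Fact (Module.finrank ℝ E = n) := ⟨by simp [Module.finrank_eq_card_basis b.toBasis]⟩
  rw [← b.toBasis.orientation.volumeForm_robust' b]
  exact b.toBasis.orientation.abs_volumeForm_apply_le v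

/-- By Cramer's rule, the coordinates of `A⁻¹ w` are quotients of determinants, and Hadamard's
inequality bounds the numerators. -/
theorem norm_symm_mul_abs_det_le (b : OrthonormalBasis (Fin n) ℝ E) (A : E ≃L[ℝ] E) {d : ℝ}
    (hd : ∀ i, ‖A (b i)‖ ≤ d) :
    ‖(A.symm : E →L[ℝ] E)‖ * |LinearMap.det (A : E →ₗ[ℝ] E)| ≤ n * d ^ (n - 1) := by
  have hdet : 0 < |LinearMap.det (A : E →ₗ[ℝ] E)| :=
    abs_pos.2 A.toLinearEquiv.isUnit_det'.ne_zero
  have hcoord (w : E) (i : Fin n) :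
      |b.repr (A.symm w) i| * |LinearMap.det (A : E →ₗ[ℝ] E)| ≤ d ^ (n - 1) * ‖w‖ := by
    have hcramer := repr_symm_apply_mul_det b.toBasis A.toLinearEquiv w i
    rw [b.coe_toBasis_repr_apply, b.coe_toBasis] at hcramer
    change |b.repr (A.toLinearEquiv.symm w) i| * |LinearMap.det (A.toLinearEquiv : E →ₗ[ℝ] E)| ≤ _
    rw [← abs_mul, hcramer]
    refine (abs_det_le_prod_norm b _).trans ?_
    rw [← Finset.prod_erase_mul _ _ (Finset.mem_univ i), Function.update_self]
    gcongr
    refine (Finset.prod_le_prod (g := fun _ => d) (fun _ _ => norm_nonneg _) fun j hj => ?_).trans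
      (by simp)
    simpa [Function.update_of_ne (Finset.ne_of_mem_erase hj)] using hd j
  have hd0 : 0 ≤ n * d ^ (n - 1) := by
    rcases n with - | n
    · simp
    · have := (norm_nonneg _).trans (hd 0)
      positivity
  rw [← le_div_iff₀ hdet]
  refine ContinuousLinearMap.opNorm_le_bound _ (by positivity) fun w => ?_
  rw [div_mul_eq_mul_div, le_div_iff₀ hdet]
  calc ‖A.symm w‖ * |LinearMap.det (A : E →ₗ[ℝ] E)|
      ≤ (∑ i, |b.repr (A.symm w) i|) * |LinearMap.det (A : E →ₗ[ℝ] E)| := by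
        gcongr
        conv_lhs => rw [← b.sum_repr (A.symm w)]
        refine (norm_sum_le _ _).trans (Finset.sum_le_sum fun i _ => ?_)
        simp [norm_smul]
    _ ≤ ∑ _i : Fin n, d ^ (n - 1) * ‖w‖ := by
        rw [Finset.sum_mul]
        exact Finset.sum_le_sum fun i _ => hcoord w i
    _ = n * d ^ (n - 1) * ‖w‖ := by simp [mul_assoc]

end Hadamard

/-- The standard basis vector `eᵢ` of `ℝⁿ`. -/
noncomputable abbrev stdVec (i : Fin n) : ℝ^n := EuclideanSpace.single i 1

theorem sum_smul_stdVec (x : ℝ^n) : ∑ i, x i • stdVec i = x := by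
  ext j
  simp [Pi.single_apply]

theorem unitCube_eq_preimage : unitCube n = WithLp.ofLp ⁻¹' Icc (0 : Fin n → ℝ) 1 := by
  ext x
  simp [unitCube, Pi.le_def, forall_and]

theorem convex_unitCube : Convex ℝ (unitCube n) := by
  rw [unitCube_eq_preimage]
  exact (convex_Icc _ _).linear_preimage (WithLp.linearEquiv 2 ℝ (Fin n → ℝ)).toLinearMap

theorem isCompact_unitCube : IsCompact (unitCube n) := by
  rw [unitCube_eq_preimage]
  exact (EuclideanSpace.equiv (Fin n) ℝ).toHomeomorph.isCompact_preimage.2 isCompact_Icc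

theorem volume_unitCube : volume (unitCube n) = 1 := by
  rw [unitCube_eq_preimage, (PiLp.volume_preserving_ofLp (Fin n)).measure_preimage
    measurableSet_Icc.nullMeasurableSet, Real.volume_Icc_pi]
  simp

theorem zero_mem_unitCube : (0 : ℝ^n) ∈ unitCube n := fun _ => by simp

theorem stdVec_mem_unitCube (i : Fin n) : stdVec i ∈ unitCube n := fun j => by
  by_cases h : j = i <;> simp [PiLp.single_apply, h]

section Parallelotope

/-- The linear part of an affine bijection of `ℝⁿ`, as a continuous linear equivalence. -/
noncomputable def linearPart (φ : ℝ^n ≃ᵃ[ℝ] ℝ^n) : ℝ^n ≃L[ℝ] ℝ^n :=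
  φ.linear.toContinuousLinearEquiv

variable (φ : ℝ^n ≃ᵃ[ℝ] ℝ^n)

theorem map_eq_linearPart_add (x : ℝ^n) : φ x = linearPart φ x + φ 0 := by
  simpa [linearPart] using φ.map_vadd 0 x

theorem map_sub_map (x y : ℝ^n) : φ x - φ y = linearPart φ (x - y) := by
  simp [map_eq_linearPart_add φ x, map_eq_linearPart_add φ y]

theorem hasFDerivAt_affineEquiv (x : ℝ^n) : HasFDerivAt φ (linearPart φ : ℝ^n →L[ℝ] ℝ^n) x := by
  rw [show ⇑φ = fun x => linearPart φ x + φ 0 from funext (map_eq_linearPart_add φ)]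
  exact (linearPart φ).hasFDerivAt.add_const _

theorem continuous_affineEquiv : Continuous φ :=
  continuous_iff_continuousAt.2 fun x => (hasFDerivAt_affineEquiv φ x).continuousAt

theorem fderiv_affineEquiv_symm (x : ℝ^n) :
    fderiv ℝ φ.symm x = ((linearPart φ).symm : ℝ^n →L[ℝ] ℝ^n) :=
  (hasFDerivAt_affineEquiv φ.symm x).fderiv

theorem isBounded_image_unitCube : Bornology.IsBounded (φ '' unitCube n) :=
  (isCompact_unitCube.image (continuous_affineEquiv φ)).isBounded

theorem norm_linearPart_sub_le {x y : ℝ^n} (hx : x ∈ unitCube n) (hy : y ∈ unitCube n) :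
    ‖linearPart φ (x - y)‖ ≤ Metric.diam (φ '' unitCube n) := by
  rw [← map_sub_map, ← dist_eq_norm]
  exact Metric.dist_le_diam_of_mem (isBounded_image_unitCube φ) (mem_image_of_mem φ hx)
    (mem_image_of_mem φ hy)

theorem norm_linearPart_stdVec_le (i : Fin n) :
    ‖linearPart φ (stdVec i)‖ ≤ Metric.diam (φ '' unitCube n) := by
  simpa using norm_linearPart_sub_le φ (stdVec_mem_unitCube i) zero_mem_unitCube

theorem fullness_image_unitCube :
    fullness (φ '' unitCube n) =
      |LinearMap.det (linearPart φ : ℝ^n →ₗ[ℝ] ℝ^n)| / Metric.diam (φ '' unitCube n) ^ n := by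
  have himage : φ '' unitCube n =
      (fun y => y + φ 0) '' ((linearPart φ : ℝ^n →ₗ[ℝ] ℝ^n) '' unitCube n) := by
    rw [image_image]
    exact image_congr fun x _ => map_eq_linearPart_add φ x
  have hvolume : volume (φ '' unitCube n) =
      ENNReal.ofReal |LinearMap.det (linearPart φ : ℝ^n →ₗ[ℝ] ℝ^n)| := by
    rw [himage, image_add_right, measure_preimage_add_right, Measure.addHaar_image_linearMap,
      volume_unitCube, mul_one]
  rw [fullness, hvolume, ENNReal.toReal_ofReal (abs_nonneg _)]

theorem diam_mul_norm_linearPart_symm_le :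
    Metric.diam (φ '' unitCube n) * ‖((linearPart φ).symm : ℝ^n →L[ℝ] ℝ^n)‖ ≤
      n / fullness (φ '' unitCube n) := by
  set d := Metric.diam (φ '' unitCube n)
  have hdet : 0 < |LinearMap.det (linearPart φ : ℝ^n →ₗ[ℝ] ℝ^n)| :=
    abs_pos.2 (linearPart φ).toLinearEquiv.isUnit_det'.ne_zero
  have hsymm := norm_symm_mul_abs_det_le (EuclideanSpace.basisFun (Fin n) ℝ) (linearPart φ)
    (d := d) fun i => by simpa using norm_linearPart_stdVec_le φ i
  rw [fullness_image_unitCube, div_div_eq_mul_div, le_div_iff₀ hdet, mul_assoc]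
  calc d * (‖((linearPart φ).symm : ℝ^n →L[ℝ] ℝ^n)‖ *
        |LinearMap.det (linearPart φ : ℝ^n →ₗ[ℝ] ℝ^n)|)
      ≤ d * (n * d ^ (n - 1)) := mul_le_mul_of_nonneg_left hsymm Metric.diam_nonneg
    _ = n * d ^ n := by
        rcases n with - | n
        · simp
        · rw [Nat.add_sub_cancel]
          ring

end Parallelotope

section Bernstein

/-- The unnormalised Bernstein polynomials `∏ xᵢ ^ aᵢ (1 - xᵢ) ^ (dᵢ - aᵢ)` of multidegree `d`;
they are the coefficients of the cubical forms. -/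
noncomputable def bernsteinFun (d a : Fin n → ℕ) (x : ℝ^n) : ℝ :=
  ∏ i, x i ^ a i * (1 - x i) ^ (d i - a i)

/-- The space of polynomial functions of multidegree at most `d`, as the span of the Bernstein
polynomials. -/
noncomputable def bernsteinSpace (d : Fin n → ℕ) : Submodule ℝ (ℝ^n → ℝ) :=
  Submodule.span ℝ (bernsteinFun d '' Iic d)

theorem bernsteinFun_mem {d a : Fin n → ℕ} (ha : a ≤ d) : bernsteinFun d a ∈ bernsteinSpace d :=
  Submodule.subset_span (mem_image_of_mem _ ha)

theorem continuous_of_mem_bernsteinSpace {d : Fin n → ℕ} {f : ℝ^n → ℝ}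
    (hf : f ∈ bernsteinSpace d) : Continuous f := by
  induction hf using Submodule.span_induction with
  | mem f hf =>
    obtain ⟨a, -, rfl⟩ := hf
    unfold bernsteinFun
    fun_prop
  | zero => exact continuous_zero
  | add f g _ _ hf hg => exact hf.add hg
  | smul c f _ hf => exact hf.const_smul c

open Polynomial in
theorem mem_span_bernstein_of_natDegree_le {R : Type*} [CommRing R] {Q : R[X]} {d : ℕ}
    (hQ : Q.natDegree ≤ d) :
    Q ∈ Submodule.span R ((fun a => X ^ a * (1 - X : R[X]) ^ (d - a)) '' Iic d) := by
  rw [Q.as_sum_range_C_mul_X_pow' (Nat.lt_succ_of_le hQ)]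
  refine Submodule.sum_mem _ fun j hj => ?_
  rw [← smul_eq_C_mul]
  refine Submodule.smul_mem _ _ ?_
  have hjd : j ≤ d := Nat.lt_succ_iff.1 (Finset.mem_range.1 hj)
  have hexpand : (X ^ j : R[X]) = X ^ j * (X + (1 - X)) ^ (d - j) := by simp
  rw [hexpand, add_pow, Finset.mul_sum]
  refine Submodule.sum_mem _ fun i hi => ?_
  have hid : j + i ≤ d := by have := Finset.mem_range.1 hi; omega
  have hterm : (X ^ j * (X ^ i * (1 - X) ^ (d - j - i) * ((d - j).choose i : R[X])) : R[X]) =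
      ((d - j).choose i : R) • (X ^ (j + i) * (1 - X) ^ (d - (j + i))) := by
    rw [smul_eq_C_mul, map_natCast, Nat.sub_sub, pow_add]
    ring
  rw [hterm]
  exact Submodule.smul_mem _ _ (Submodule.subset_span (mem_image_of_mem _ hid))

theorem prod_eval_mem_bernsteinSpace {d : Fin n → ℕ} (Q : Fin n → Polynomial ℝ)
    (hQ : ∀ i, (Q i).natDegree ≤ d i) :
    (fun x : ℝ^n => ∏ i, (Q i).eval (x i)) ∈ bernsteinSpace d := by
  have hcoeff (i : Fin n) := by
    have h := mem_span_bernstein_of_natDegree_le (hQ i)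
    rwa [← Finset.coe_Iic, Submodule.mem_span_image_finset_iff_exists_fun'] at h
  choose c hc using hcoeff
  have hprod : (fun x : ℝ^n => ∏ i, (Q i).eval (x i)) =
      ∑ a ∈ Finset.Iic d, (∏ i, c i (a i)) • bernsteinFun d a := by
    ext x
    simp_rw [← hc, Polynomial.eval_finsetSum]
    rw [Finset.prod_univ_sum, Finset.sum_apply]
    refine Finset.sum_congr rfl fun a _ => ?_
    simp [bernsteinFun, Finset.prod_mul_distrib]
  rw [hprod]
  exact Submodule.sum_mem _ fun a ha =>
    Submodule.smul_mem _ _ (bernsteinFun_mem (Finset.mem_Iic.1 ha))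

theorem prod_apply_mem_bernsteinSpace {d : Fin n → ℕ} {j : ℕ} (hj : ∀ i, j ≤ d i)
    (r : Fin j → Fin n) : (fun x : ℝ^n => ∏ l, x (r l)) ∈ bernsteinSpace d := by
  have hmem := prod_eval_mem_bernsteinSpace (d := d)
    (fun i => Polynomial.X ^ (Finset.univ.filter fun l => r l = i).card) fun i => by
      simpa using (Finset.card_le_univ _).trans ((Fintype.card_fin j).trans_le (hj i))
  convert hmem using 2 with x
  rw [← Finset.prod_fiberwise (s := Finset.univ) (g := r)]
  refine Finset.prod_congr rfl fun i _ => ?_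
  rw [Finset.prod_congr rfl (g := fun _ => x i) fun l hl => by rw [(Finset.mem_filter.1 hl).2]]
  simp

theorem multilinear_diagonal_mem_bernsteinSpace {d : Fin n → ℕ} {j : ℕ} (hj : ∀ i, j ≤ d i)
    (L : MultilinearMap ℝ (fun _ : Fin j => ℝ^n) ℝ) :
    (fun x => L fun _ => x) ∈ bernsteinSpace d := by
  have hL : (fun x => L fun _ => x) = ∑ r : Fin j → Fin n,
      L (fun l => stdVec (r l)) • fun x : ℝ^n => ∏ l, x (r l) := by
    ext x
    conv_lhs => rw [← sum_smul_stdVec x]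
    rw [L.map_sum, Finset.sum_apply]
    refine Finset.sum_congr rfl fun r _ => ?_
    rw [L.map_smul_univ, Pi.smul_apply, smul_eq_mul, smul_eq_mul, mul_comm]
  rw [hL]
  exact Submodule.sum_mem _ fun r _ => Submodule.smul_mem _ _ (prod_apply_mem_bernsteinSpace hj r)

theorem taylorSum_mem_bernsteinSpace {d : Fin n → ℕ} {k : ℕ} (hd : ∀ i, k ≤ d i + 1)
    (g : ℝ^n → ℝ) (c : ℝ^n) :
    (fun v => ∑ j ∈ Finset.range k,
      (j.factorial : ℝ)⁻¹ • iteratedFDeriv ℝ j g c fun _ => v) ∈ bernsteinSpace d := by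
  rw [← Finset.sum_fn]
  refine Submodule.sum_mem _ fun j hj => Submodule.smul_mem _ _ ?_
  exact multilinear_diagonal_mem_bernsteinSpace
    (fun i => by have := hd i; have := Finset.mem_range.1 hj; omega)
    (iteratedFDeriv ℝ j g c).toMultilinearMap

end Bernstein

section SmallCubes

/-- The degree in the coordinate `i` of the coefficients of `dx I` in the `k`th order cubical
forms. The multi-indices `a ≤ coeffDegree k I` also index the small cubes with directions `I`. -/
def coeffDegree (k : ℕ) (I : Fin p ↪o Fin n) (i : Fin n) : ℕ :=
  if i ∈ Set.range I then k - 1 else k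

theorem le_coeffDegree_add_one (k : ℕ) (I : Fin p ↪o Fin n) (i : Fin n) :
    k ≤ coeffDegree k I i + 1 := by
  unfold coeffDegree
  split_ifs <;> omega

/-- The parametrisation by `[0,1]^p` of the small cube of `□ⁿ` with lowest corner `a / k` and
directions `I`. -/
noncomputable def gridCube (k : ℕ) (I : Fin p ↪o Fin n) (a : Fin n → ℕ) (t : Fin p → ℝ) : ℝ^n :=
  (k : ℝ)⁻¹ • (WithLp.toLp 2 (fun i => (a i : ℝ)) + ∑ j, t j • stdVec (I j))

theorem gridCube_apply_dir (k : ℕ) (I : Fin p ↪o Fin n) (a : Fin n → ℕ) (t : Fin p → ℝ)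
    (j : Fin p) : gridCube k I a t (I j) = ((a (I j) : ℝ) + t j) / k := by
  simp [gridCube, Pi.single_apply, div_eq_inv_mul, mul_add]

theorem gridCube_apply_of_notMem (k : ℕ) {I : Fin p ↪o Fin n} (a : Fin n → ℕ) (t : Fin p → ℝ)
    {i : Fin n} (hi : i ∉ Set.range I) : gridCube k I a t i = (a i : ℝ) / k := by
  have hne (j : Fin p) : i ≠ I j := fun h => hi ⟨j, h.symm⟩
  simp [gridCube, hne, div_eq_inv_mul]

theorem continuous_gridCube (k : ℕ) (I : Fin p ↪o Fin n) (a : Fin n → ℕ) :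
    Continuous (gridCube k I a) := by
  unfold gridCube
  fun_prop

variable {k : ℕ} {I : Fin p ↪o Fin n} {a : Fin n → ℕ}

theorem gridCube_mem_unitCube (hk : 1 ≤ k) (ha : a ≤ coeffDegree k I) {t : Fin p → ℝ}
    (ht : t ∈ Icc 0 1) : gridCube k I a t ∈ unitCube n := by
  have hk' : (0 : ℝ) < k := by exact_mod_cast hk
  intro i
  have hai := ha i
  by_cases hi : i ∈ Set.range I
  · rw [coeffDegree, if_pos hi] at hai
    obtain ⟨j, rfl⟩ := hi
    have hak : (a (I j) : ℝ) + 1 ≤ k := by exact_mod_cast (Nat.le_sub_one_iff_lt hk).1 hai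
    have ht0 : 0 ≤ t j := ht.1 j
    have ht1 : t j ≤ 1 := ht.2 j
    rw [gridCube_apply_dir]
    exact ⟨by positivity, (div_le_one hk').2 (by linarith)⟩
  · rw [coeffDegree, if_neg hi] at hai
    rw [gridCube_apply_of_notMem k a t hi]
    exact ⟨by positivity, (div_le_one hk').2 (by exact_mod_cast hai)⟩

/-- The mean of a function over a small cube of `□ⁿ`. -/
noncomputable def cubeMean (k : ℕ) (I : Fin p ↪o Fin n) (a : Fin n → ℕ) (f : ℝ^n → ℝ) : ℝ :=
  ∫ t in Icc (0 : Fin p → ℝ) 1, f (gridCube k I a t)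

theorem integrableOn_comp_gridCube (hk : 1 ≤ k) (ha : a ≤ coeffDegree k I) {f : ℝ^n → ℝ}
    (hf : ContinuousOn f (unitCube n)) :
    IntegrableOn (fun t => f (gridCube k I a t)) (Icc (0 : Fin p → ℝ) 1) :=
  (hf.comp (continuous_gridCube k I a).continuousOn
    fun _ ht => gridCube_mem_unitCube hk ha ht).integrableOn_compact isCompact_Icc

theorem cubeMean_add (hk : 1 ≤ k) (ha : a ≤ coeffDegree k I) {f g : ℝ^n → ℝ}
    (hf : ContinuousOn f (unitCube n)) (hg : ContinuousOn g (unitCube n)) :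
    cubeMean k I a (f + g) = cubeMean k I a f + cubeMean k I a g :=
  integral_add (integrableOn_comp_gridCube hk ha hf) (integrableOn_comp_gridCube hk ha hg)

theorem cubeMean_sub (hk : 1 ≤ k) (ha : a ≤ coeffDegree k I) {f g : ℝ^n → ℝ}
    (hf : ContinuousOn f (unitCube n)) (hg : ContinuousOn g (unitCube n)) :
    cubeMean k I a (f - g) = cubeMean k I a f - cubeMean k I a g :=
  integral_sub (integrableOn_comp_gridCube hk ha hf) (integrableOn_comp_gridCube hk ha hg)

theorem cubeMean_smul (k : ℕ) (I : Fin p ↪o Fin n) (a : Fin n → ℕ) (c : ℝ) (f : ℝ^n → ℝ) :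
    cubeMean k I a (c • f) = c * cubeMean k I a f :=
  integral_const_mul c _

theorem abs_cubeMean_le (hk : 1 ≤ k) (ha : a ≤ coeffDegree k I) {f : ℝ^n → ℝ} {B : ℝ}
    (hf : ∀ x ∈ unitCube n, |f x| ≤ B) : |cubeMean k I a f| ≤ B := by
  have hvolume : volume (Icc (0 : Fin p → ℝ) 1) = 1 := by simp [Real.volume_Icc_pi]
  have hle := norm_setIntegral_le_of_norm_le_const (μ := volume) (s := Icc (0 : Fin p → ℝ) 1)
    (f := fun t => f (gridCube k I a t)) (by simp [hvolume])
    fun t ht => hf _ (gridCube_mem_unitCube hk ha ht)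
  simpa [cubeMean, Measure.real, hvolume] using hle

end SmallCubes

section DualBasis

/-- The factor in the coordinate `i` of the mean over a small cube with directions `I`. -/
noncomputable def coordMean (k : ℕ) (I : Fin p ↪o Fin n) (i : Fin n) (m : ℕ) (u : ℝ → ℝ) : ℝ :=
  if i ∈ Set.range I then ∫ t in Icc (0 : ℝ) 1, u ((m + t) / k) else u (m / k)

theorem prod_eq_prod_dir_mul_prod_compl {M : Type*} [CommMonoid M] (I : Fin p ↪o Fin n)
    (f : Fin n → M) : ∏ i, f i = (∏ j, f (I j)) * ∏ i ∈ (Finset.univ.image I)ᶜ, f i := by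
  rw [← Finset.prod_mul_prod_compl (Finset.univ.image I), Finset.prod_image I.injective.injOn]

theorem cubeMean_prod (k : ℕ) (I : Fin p ↪o Fin n) (a : Fin n → ℕ) (u : Fin n → ℝ → ℝ) :
    cubeMean k I a (fun x => ∏ i, u i (x i)) = ∏ i, coordMean k I i (a i) (u i) := by
  have hcompl {i : Fin n} (hi : i ∈ (Finset.univ.image I)ᶜ) : i ∉ Set.range I := by simpa using hi
  have hsplit (t : Fin p → ℝ) : ∏ i, u i (gridCube k I a t i) =
      (∏ j, u (I j) (((a (I j) : ℝ) + t j) / k)) *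
        ∏ i ∈ (Finset.univ.image I)ᶜ, coordMean k I i (a i) (u i) := by
    rw [prod_eq_prod_dir_mul_prod_compl I]
    simp_rw [gridCube_apply_dir]
    congr 1
    refine Finset.prod_congr rfl fun i hi => ?_
    rw [gridCube_apply_of_notMem _ _ _ (hcompl hi), coordMean, if_neg (hcompl hi)]
  have hdir (j : Fin p) : coordMean k I (I j) (a (I j)) (u (I j)) =
      ∫ t in Icc (0 : ℝ) 1, u (I j) (((a (I j) : ℝ) + t) / k) := if_pos ⟨j, rfl⟩
  unfold cubeMean
  simp_rw [hsplit]
  rw [integral_mul_const, prod_eq_prod_dir_mul_prod_compl I]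
  simp_rw [hdir]
  congr 1
  rw [← pi_univ_Icc, volume_pi, Measure.restrict_pi_pi]
  exact integral_fintype_prod_eq_prod
    fun (j : Fin p) (t : ℝ) => u (I j) (((a (I j) : ℝ) + t) / k)

variable {k : ℕ}

theorem exists_lagrange (hk : 1 ≤ k) (y : ℕ → ℝ) : ∃ P : Polynomial ℝ, P.natDegree ≤ k ∧
    ∀ j ≤ k, P.eval ((j : ℝ) / k) = y j := by
  have hk' : (k : ℝ) ≠ 0 := by positivity
  have hinj : Set.InjOn (fun j : ℕ => (j : ℝ) / k) (Finset.range (k + 1)) := by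
    intro i _ j _ h
    simpa [div_left_inj' hk'] using h
  refine ⟨Lagrange.interpolate (Finset.range (k + 1)) (fun j : ℕ => (j : ℝ) / k) y,
    Polynomial.natDegree_le_of_degree_le ((Lagrange.degree_interpolate_le y hinj).trans ?_),
    fun j hj => Lagrange.eval_interpolate_at_node y hinj (Finset.mem_range.2 (by omega))⟩
  simp

/-- The derivative of a polynomial has prescribed means if the polynomial has prescribed increments
at the nodes. -/
theorem exists_polynomial_integral_eq (hk : 1 ≤ k) (y : ℕ → ℝ) : ∃ P : Polynomial ℝ,
    P.natDegree ≤ k - 1 ∧ ∀ j < k, ∫ t in Icc (0 : ℝ) 1, P.eval (((j : ℝ) + t) / k) = y j := by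
  have hk' : (k : ℝ) ≠ 0 := by positivity
  obtain ⟨P, hP, hPj⟩ := exists_lagrange hk fun j => (k : ℝ)⁻¹ * ∑ i ∈ Finset.range j, y i
  refine ⟨P.derivative, (Polynomial.natDegree_derivative_le P).trans (by omega), fun j hj => ?_⟩
  have hder (t : ℝ) : HasDerivAt (fun t : ℝ => k * P.eval (((j : ℝ) + t) / k))
      (P.derivative.eval (((j : ℝ) + t) / k)) t := by
    have hline : HasDerivAt (fun t : ℝ => ((j : ℝ) + t) / k) (1 / k) t :=
      ((hasDerivAt_id t).const_add _).div_const _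
    exact (((P.hasDerivAt _).comp t hline).const_mul (k : ℝ)).congr_deriv (by field_simp)
  have hsucc := hPj (j + 1) hj
  push_cast at hsucc
  rw [integral_Icc_eq_integral_Ioc, ← intervalIntegral.integral_of_le zero_le_one,
    intervalIntegral.integral_eq_sub_of_hasDerivAt (fun t _ => hder t)
      (Continuous.intervalIntegrable (by fun_prop) _ _),
    hsucc, add_zero, hPj j hj.le, Finset.sum_range_succ]
  field_simp
  ring

theorem exists_polynomial_coordMean_eq (hk : 1 ≤ k) (I : Fin p ↪o Fin n) (i : Fin n) (y : ℕ → ℝ) :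
    ∃ P : Polynomial ℝ, P.natDegree ≤ coeffDegree k I i ∧
      ∀ j ≤ coeffDegree k I i, coordMean k I i j (fun x => P.eval x) = y j := by
  by_cases hi : i ∈ Set.range I
  · simp only [coeffDegree, coordMean, if_pos hi]
    obtain ⟨P, hP, hPy⟩ := exists_polynomial_integral_eq hk y
    exact ⟨P, hP, fun j hj => hPy j (by omega)⟩
  · simp only [coeffDegree, coordMean, if_neg hi]
    exact exists_lagrange hk y

theorem exists_dual (hk : 1 ≤ k) (I : Fin p ↪o Fin n) (a : Fin n → ℕ) :
    ∃ u ∈ bernsteinSpace (coeffDegree k I),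
      ∀ b ≤ coeffDegree k I, cubeMean k I b u = if b = a then 1 else 0 := by
  choose P hdeg hP using
    fun i => exists_polynomial_coordMean_eq hk I i fun j => if j = a i then 1 else 0
  refine ⟨_, prod_eval_mem_bernsteinSpace P hdeg, fun b hb => ?_⟩
  rw [cubeMean_prod k I b fun i x => (P i).eval x, Finset.prod_congr rfl fun i _ => hP i _ (hb i),
    Finset.prod_ite_zero]
  simp [funext_iff]

end DualBasis

section Interpolation

variable {k : ℕ} (hk : 1 ≤ k) (I : Fin p ↪o Fin n)

/-- The means over the small cubes with directions `I`, as a linear map on the coefficients of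
`dx I` in the `k`th order cubical forms. -/
noncomputable def cubeMeans :
    bernsteinSpace (coeffDegree k I) →ₗ[ℝ] (Finset.Iic (coeffDegree k I) → ℝ) where
  toFun f a := cubeMean k I a f
  map_add' f g := funext fun a => cubeMean_add hk (Finset.mem_Iic.1 a.2)
    (continuous_of_mem_bernsteinSpace f.2).continuousOn
    (continuous_of_mem_bernsteinSpace g.2).continuousOn
  map_smul' c f := funext fun a => cubeMean_smul k I a c f

theorem cubeMeans_surjective : Function.Surjective (cubeMeans hk I) := by
  choose u hu hdual using exists_dual hk I
  have hdual' (a b : Finset.Iic (coeffDegree k I)) :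
      cubeMeans hk I ⟨u a, hu a⟩ b = if b = a then 1 else 0 := by
    simp only [Subtype.ext_iff]
    exact hdual a b (Finset.mem_Iic.1 b.2)
  intro y
  refine ⟨∑ a, y a • ⟨u a, hu a⟩, funext fun b => ?_⟩
  simp only [map_sum, map_smul, Finset.sum_apply, Pi.smul_apply, hdual', smul_eq_mul, mul_ite,
    mul_one, mul_zero, Finset.sum_ite_eq, Finset.mem_univ, if_true]

theorem cubeMeans_bijective : Function.Bijective (cubeMeans hk I) := by
  classical
  have hspan : bernsteinSpace (coeffDegree k I) = Submodule.span ℝ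
      ((Finset.Iic (coeffDegree k I)).image (bernsteinFun (coeffDegree k I)) : Set (ℝ^n → ℝ)) := by
    simp only [bernsteinSpace, Finset.coe_image, Finset.coe_Iic]
  have hfinite : Module.Finite ℝ (bernsteinSpace (coeffDegree k I)) := by
    rw [hspan]
    infer_instance
  have hle : Module.finrank ℝ (bernsteinSpace (coeffDegree k I)) ≤
      Module.finrank ℝ (Finset.Iic (coeffDegree k I) → ℝ) := by
    rw [Module.finrank_fintype_fun_eq_card, Fintype.card_coe, hspan]
    exact (finrank_span_finset_le_card _).trans Finset.card_image_le
  have hsurj := cubeMeans_surjective hk I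
  exact ⟨(LinearMap.injective_iff_surjective_of_finrank_eq_finrank (hle.antisymm
    (LinearMap.finrank_le_finrank_of_surjective hsurj))).2 hsurj, hsurj⟩

theorem exists_abs_le_of_abs_cubeMean_le (hk : 1 ≤ k) (I : Fin p ↪o Fin n) :
    ∃ Λ : ℝ, 0 ≤ Λ ∧ ∀ f ∈ bernsteinSpace (coeffDegree k I), ∀ B : ℝ,
      (∀ a ≤ coeffDegree k I, |cubeMean k I a f| ≤ B) → ∀ x ∈ unitCube n, |f x| ≤ Λ * B := by
  set e := LinearEquiv.ofBijective _ (cubeMeans_bijective hk I)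
  set u : Finset.Iic (coeffDegree k I) → bernsteinSpace (coeffDegree k I) :=
    fun a => e.symm fun b => if a = b then 1 else 0
  choose C hC using fun a => isCompact_unitCube.exists_bound_of_continuousOn (f := (u a).1)
    (continuous_of_mem_bernsteinSpace (u a).2).continuousOn
  have hC0 (a) : 0 ≤ C a := (norm_nonneg _).trans (hC a 0 zero_mem_unitCube)
  refine ⟨∑ a, C a, Finset.sum_nonneg fun a _ => hC0 a, fun f hf B hB x hx => ?_⟩
  have hexpand : f = ∑ a : Finset.Iic (coeffDegree k I), cubeMean k I a f • (u a).1 := by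
    have h := LinearMap.pi_apply_eq_sum_univ e.symm.toLinearMap (e ⟨f, hf⟩)
    rw [LinearEquiv.coe_coe, e.symm_apply_apply] at h
    exact (congrArg Subtype.val h).trans (Submodule.coe_sum _ _ _)
  rw [hexpand, Finset.sum_apply, Finset.sum_mul]
  refine (Finset.abs_sum_le_sum_abs _ _).trans (Finset.sum_le_sum fun a _ => ?_)
  rw [Pi.smul_apply, smul_eq_mul, abs_mul, mul_comm]
  exact mul_le_mul (hC a x hx) (hB a (Finset.mem_Iic.1 a.2)) (abs_nonneg _) (hC0 a)

/-- The Taylor polynomial of degree `k - 1` at a corner of the cube has the multidegree of the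
interpolant, so the interpolation error is at most `1 + Λ` times the Taylor remainder. -/
theorem exists_abs_sub_le_of_cubeMean_eq (hk : 1 ≤ k) (I : Fin p ↪o Fin n) :
    ∃ C : ℝ, 0 ≤ C ∧ ∀ f ∈ bernsteinSpace (coeffDegree k I), ∀ g : ℝ^n → ℝ,
      (∀ x ∈ unitCube n, ContDiffAt ℝ k g x) →
      (∀ a ≤ coeffDegree k I, cubeMean k I a f = cubeMean k I a g) →
      ∀ B : ℝ, (∀ x ∈ unitCube n, ∀ v ∈ unitCube n, |iteratedFDeriv ℝ k g x fun _ => v| ≤ B) →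
      ∀ x ∈ unitCube n, |f x - g x| ≤ C * B := by
  obtain ⟨Λ, hΛ, hstable⟩ := exists_abs_le_of_abs_cubeMean_le hk I
  refine ⟨Λ + 1, by positivity, fun f hf g hg hfg B hB x hx => ?_⟩
  set T : ℝ^n → ℝ := fun v =>
    ∑ j ∈ Finset.range k, (j.factorial : ℝ)⁻¹ • iteratedFDeriv ℝ j g 0 fun _ => v
  have hT : T ∈ bernsteinSpace (coeffDegree k I) :=
    taylorSum_mem_bernsteinSpace (le_coeffDegree_add_one k I) g 0
  have hremainder : ∀ v ∈ unitCube n, |g v - T v| ≤ B := fun v hv => by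
    have hseg : ∀ t ∈ Icc (0 : ℝ) 1, 0 + t • v ∈ unitCube n := fun t ht => by
      simpa using convex_unitCube.smul_mem_of_zero_mem zero_mem_unitCube hv ht
    simpa only [zero_add, Real.norm_eq_abs] using norm_sub_taylorSum_le
      (fun t ht => hg _ (hseg t ht)) fun t ht => hB _ (hseg t ht) v hv
  have hfT : |f x - T x| ≤ Λ * B := by
    refine hstable (f - T) (Submodule.sub_mem _ hf hT) B (fun a ha => ?_) x hx
    have hgcont : ContinuousOn g (unitCube n) :=
      fun x hx => (hg x hx).continuousAt.continuousWithinAt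
    have hTcont := (continuous_of_mem_bernsteinSpace hT).continuousOn (s := unitCube n)
    rw [cubeMean_sub hk ha (continuous_of_mem_bernsteinSpace hf).continuousOn hTcont, hfg a ha,
      ← cubeMean_sub hk ha hgcont hTcont]
    exact abs_cubeMean_le hk ha hremainder
  calc |f x - g x| ≤ |f x - T x| + |T x - g x| := abs_sub_le _ _ _
    _ ≤ Λ * B + B := add_le_add hfT (by rw [abs_sub_comm]; exact hremainder x hx)
    _ = (Λ + 1) * B := by ring

end Interpolation

section Alternating

theorem ext_alternating_orderEmbedding {ι R M N : Type*} [LinearOrder ι] [CommRing R]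
    [AddCommGroup M] [Module R M] [AddCommGroup N] [Module R N] (b : Module.Basis ι R M)
    {α β : M [⋀^Fin p]→ₗ[R] N} (h : ∀ I : Fin p ↪o ι, α (b ∘ I) = β (b ∘ I)) : α = β := by
  refine b.ext_alternating fun v hv => ?_
  have hsort : StrictMono (v ∘ Tuple.sort v) :=
    (Tuple.monotone_sort v).strictMono_of_injective (hv.comp (Tuple.sort v).injective)
  rw [α.map_congr_perm _ (Tuple.sort v), β.map_congr_perm _ (Tuple.sort v)]
  exact congrArg _ (h (OrderEmbedding.ofStrictMono _ hsort))

theorem dx_apply_stdVec (I J : Fin p ↪o Fin n) :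
    dx J (fun j => stdVec (I j)) = if I = J then 1 else 0 := by
  set x : Fin n → ℝ^n := stdVec
  set f : Fin n → Module.Dual ℝ (ℝ^n) := fun i => (EuclideanSpace.proj i : ℝ^n →L[ℝ] ℝ)
  have hpairing : dx J (fun j => stdVec (I j)) = exteriorPower.pairingDual ℝ (ℝ^n) p
      (exteriorPower.ιMulti ℝ p (f ∘ J)) (exteriorPower.ιMulti ℝ p (x ∘ I)) := by
    rw [exteriorPower.pairingDual_ιMulti_ιMulti]
    rfl
  have h₁ (i : Fin n) : f i (x i) = 1 := by simp [f, x]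
  have h₀ ⦃i j : Fin n⦄ (hij : i ≠ j) : f i (x j) = 0 := by simp [f, x, hij]
  rw [hpairing]
  split_ifs with hIJ
  · rw [hIJ, exteriorPower.pairingDual_apply_apply_eq_one x f h₁ h₀]
  · exact exteriorPower.pairingDual_apply_apply_eq_one_zero x f h₀ p J I (Ne.symm hIJ)

end Alternating

section Frame

variable (φ : ℝ^n ≃ᵃ[ℝ] ℝ^n)

/-- The edge vectors of a parallelotope in the directions `I`. -/
noncomputable def frame (I : Fin p ↪o Fin n) (j : Fin p) : ℝ^n :=
  linearPart φ (stdVec (I j))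

/-- The form `dx I` of `□ⁿ`, carried to a parallelotope. -/
noncomputable def cellDx (I : Fin p ↪o Fin n) : ℝ^n [⋀^Fin p]→L[ℝ] ℝ :=
  (dx I).compContinuousLinearMap (linearPart φ).symm

theorem cellDx_apply_frame (I J : Fin p ↪o Fin n) :
    cellDx φ J (frame φ I) = if I = J then 1 else 0 := by
  rw [← dx_apply_stdVec]
  simp [cellDx, frame, Function.comp_def]

theorem eq_of_apply_frame_eq {α β : ℝ^n [⋀^Fin p]→L[ℝ] ℝ}
    (h : ∀ I : Fin p ↪o Fin n, α (frame φ I) = β (frame φ I)) : α = β := by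
  set b := (EuclideanSpace.basisFun (Fin n) ℝ).toBasis.map (linearPart φ).toLinearEquiv
  have hb (I : Fin p ↪o Fin n) : b ∘ I = frame φ I := by
    ext1 j
    simp [b, frame]
  refine ContinuousAlternatingMap.toAlternatingMap_injective
    (ext_alternating_orderEmbedding b fun I => ?_)
  rw [hb]
  exact h I

theorem sum_apply_frame_smul_cellDx (α : ℝ^n [⋀^Fin p]→L[ℝ] ℝ) :
    ∑ I : Fin p ↪o Fin n, α (frame φ I) • cellDx φ I = α := by
  refine eq_of_apply_frame_eq φ fun J => ?_
  simp [ContinuousAlternatingMap.sum_apply, cellDx_apply_frame]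

theorem norm_le_sum_apply_frame (α : ℝ^n [⋀^Fin p]→L[ℝ] ℝ) :
    ‖α‖ ≤ ∑ I : Fin p ↪o Fin n, |α (frame φ I)| *
      (‖(dx I : ℝ^n [⋀^Fin p]→L[ℝ] ℝ)‖ * ‖((linearPart φ).symm : ℝ^n →L[ℝ] ℝ^n)‖ ^ p) := by
  conv_lhs => rw [← sum_apply_frame_smul_cellDx φ α]
  refine (norm_sum_le _ _).trans (Finset.sum_le_sum fun I _ => ?_)
  rw [norm_smul, Real.norm_eq_abs]
  gcongr
  simpa [cellDx] using ContinuousAlternatingMap.norm_compContinuousLinearMap_le (dx I)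
    ((linearPart φ).symm : ℝ^n →L[ℝ] ℝ^n)

end Frame

section CellSpace

variable (φ : ℝ^n ≃ᵃ[ℝ] ℝ^n) {k : ℕ}

/-- The coefficient of `dx I` in the pullback of a form to `□ⁿ`. -/
noncomputable def cellCoeff (I : Fin p ↪o Fin n) : DForm n p →ₗ[ℝ] (ℝ^n → ℝ) where
  toFun η x := η (φ x) (frame φ I)
  map_add' _ _ := rfl
  map_smul' _ _ := rfl

theorem cellCoeff_apply (I : Fin p ↪o Fin n) (η : DForm n p) (x : ℝ^n) :
    cellCoeff φ I η x = η (φ x) (frame φ I) := rfl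

/-- The form on a parallelotope whose pullback to `□ⁿ` is `f dx I`. -/
noncomputable def cellForm (I : Fin p ↪o Fin n) : (ℝ^n → ℝ) →ₗ[ℝ] DForm n p where
  toFun f y := f (φ.symm y) • cellDx φ I
  map_add' _ _ := funext fun _ => add_smul _ _ _
  map_smul' _ _ := funext fun _ => mul_smul _ _ _

theorem cellForm_apply (I : Fin p ↪o Fin n) (f : ℝ^n → ℝ) (y : ℝ^n) :
    cellForm φ I f y = f (φ.symm y) • cellDx φ I := rfl

theorem cellCoeff_cellForm (I J : Fin p ↪o Fin n) (f : ℝ^n → ℝ) :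
    cellCoeff φ I (cellForm φ J f) = if I = J then f else 0 := by
  ext x
  rw [cellCoeff_apply, cellForm_apply, ContinuousAlternatingMap.smul_apply, cellDx_apply_frame,
    φ.symm_apply_apply]
  split_ifs <;> simp

theorem cellCoeff_sum_cellForm (I : Fin p ↪o Fin n) (f : (Fin p ↪o Fin n) → ℝ^n → ℝ) :
    cellCoeff φ I (∑ J, cellForm φ J (f J)) = f I := by
  simp [map_sum, cellCoeff_cellForm]

theorem sum_cellForm_cellCoeff (η : DForm n p) : ∑ I, cellForm φ I (cellCoeff φ I η) = η := by
  ext1 y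
  simp_rw [Finset.sum_apply, cellForm_apply, cellCoeff_apply, φ.apply_symm_apply]
  exact sum_apply_frame_smul_cellDx φ (η y)

/-- The index of the small cube given by `m` and `τ` among those with directions `τ.dir`. -/
def gridIndex (m : Fin n → Fin k) (τ : Face n p) (i : Fin n) : ℕ := m i + τ.val i

theorem gridIndex_le_coeffDegree (m : Fin n → Fin k) (τ : Face n p) :
    gridIndex m τ ≤ coeffDegree k τ.dir := by
  intro i
  have hm := (m i).isLt
  have hval := (τ.val i).isLt
  change (m i : ℕ) + τ.val i ≤ if i ∈ Set.range τ.dir then k - 1 else k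
  split_ifs with hi
  · obtain ⟨j, rfl⟩ := hi
    rw [τ.val_dir, Fin.val_zero]
    omega
  · omega

theorem exists_gridIndex_eq (hk : 1 ≤ k) {I : Fin p ↪o Fin n} {a : Fin n → ℕ}
    (ha : a ≤ coeffDegree k I) :
    ∃ (m : Fin n → Fin k) (τ : Face n p), τ.dir = I ∧ gridIndex m τ = a := by
  refine ⟨fun i => ⟨min (a i) (k - 1), by omega⟩,
    ⟨I, fun i => if a i < k then 0 else 1, fun j => if_pos ?_⟩, rfl, funext fun i => ?_⟩
  · have hdir := ha (I j)
    simp only [coeffDegree, Set.mem_range_self, if_true] at hdir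
    omega
  · have hai : a i ≤ k := by
      have hdeg : a i ≤ if i ∈ Set.range I then k - 1 else k := ha i
      split_ifs at hdeg <;> omega
    by_cases hik : a i < k
    · simp only [gridIndex, if_pos hik, Fin.val_zero]
      omega
    · simp only [gridIndex, if_neg hik, Fin.val_one]
      omega

theorem prod_mul_prod_compl_eq_bernsteinFun (m : Fin n → Fin k) (τ : Face n p) (x : ℝ^n) :
    (∏ i, x i ^ (m i : ℕ) * (1 - x i) ^ (k - 1 - (m i : ℕ))) *
      ∏ i ∈ (Finset.univ.image τ.dir)ᶜ, x i ^ (τ.val i : ℕ) * (1 - x i) ^ (1 - (τ.val i : ℕ)) =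
    bernsteinFun (coeffDegree k τ.dir) (gridIndex m τ) x := by
  unfold bernsteinFun
  rw [prod_eq_prod_dir_mul_prod_compl τ.dir, prod_eq_prod_dir_mul_prod_compl τ.dir
    (fun i => x i ^ gridIndex m τ i * _), mul_assoc, ← Finset.prod_mul_distrib]
  congr 1
  · refine Finset.prod_congr rfl fun j _ => ?_
    simp [gridIndex, τ.val_dir, coeffDegree]
  · refine Finset.prod_congr rfl fun i hi => ?_
    have hi' : i ∉ Set.range τ.dir := by simpa using hi
    have hm := (m i).isLt
    have hval := (τ.val i).isLt
    have hexponent : k - ((m i : ℕ) + (τ.val i : ℕ)) =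
        (k - 1 - (m i : ℕ)) + (1 - (τ.val i : ℕ)) := by omega
    simp only [gridIndex, coeffDegree, hi', if_false]
    rw [hexponent, pow_add, pow_add]
    ring

theorem pullback_symm_cubicalForm (m : Fin n → Fin k) (τ : Face n p) :
    pullback φ.symm (cubicalForm k m τ) =
      cellForm φ τ.dir (bernsteinFun (coeffDegree k τ.dir) (gridIndex m τ)) := by
  ext1 y
  unfold pullback cubicalForm lowestForm
  rw [fderiv_affineEquiv_symm, smul_smul, prod_mul_prod_compl_eq_bernsteinFun]
  rfl

theorem mem_cellSpace_iff (hk : 1 ≤ k) {η : DForm n p} : η ∈ cellSpace φ k p ↔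
    ∀ I : Fin p ↪o Fin n, cellCoeff φ I η ∈ bernsteinSpace (coeffDegree k I) := by
  constructor
  · intro hη I
    have hle : cellSpace φ k p ≤ (bernsteinSpace (coeffDegree k I)).comap (cellCoeff φ I) := by
      refine Submodule.span_le.2 ?_
      rintro _ ⟨m, τ, rfl⟩
      rw [SetLike.mem_coe, Submodule.mem_comap, pullback_symm_cubicalForm, cellCoeff_cellForm]
      split_ifs with hI
      · rw [hI]
        exact bernsteinFun_mem (gridIndex_le_coeffDegree m τ)
      · exact Submodule.zero_mem _
    exact hle hη
  · intro hη
    rw [← sum_cellForm_cellCoeff φ η]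
    refine Submodule.sum_mem _ fun I _ => ?_
    have hle : bernsteinSpace (coeffDegree k I) ≤ (cellSpace φ k p).comap (cellForm φ I) := by
      refine Submodule.span_le.2 ?_
      rintro _ ⟨a, ha, rfl⟩
      obtain ⟨m, τ, rfl, rfl⟩ := exists_gridIndex_eq hk ha
      exact Submodule.subset_span ⟨m, τ, (pullback_symm_cubicalForm φ m τ).symm⟩
    exact hle (hη I)

end CellSpace

section Integrals

variable (φ : ℝ^n ≃ᵃ[ℝ] ℝ^n) {k : ℕ}

theorem smallCube_eq (m : Fin n → Fin k) (τ : Face n p) :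
    smallCube φ k m τ = φ ∘ gridCube k τ.dir (gridIndex m τ) := by
  ext1 t
  refine congrArg φ ?_
  ext i
  simp [smallMap, Face.param, gridCube, gridIndex, Pi.single_apply, div_eq_inv_mul, mul_add,
    add_assoc, eq_comm (a := i)]

theorem hasFDerivAt_gridCube (k : ℕ) (I : Fin p ↪o Fin n) (a : Fin n → ℕ) (t : Fin p → ℝ) :
    HasFDerivAt (gridCube k I a) ((k : ℝ)⁻¹ • ∑ j,
      (ContinuousLinearMap.proj j : (Fin p → ℝ) →L[ℝ] ℝ).smulRight (stdVec (I j))) t := by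
  have hsum := HasFDerivAt.fun_sum (u := Finset.univ) fun j _ =>
    (hasFDerivAt_apply (𝕜 := ℝ) j t).smul_const (stdVec (I j))
  exact (hsum.const_add _).fun_const_smul _

theorem fderiv_smallCube (m : Fin n → Fin k) (τ : Face n p) (t : Fin p → ℝ) (j : Fin p) :
    fderiv ℝ (smallCube φ k m τ) t (Pi.single j 1) = (k : ℝ)⁻¹ • frame φ τ.dir j := by
  rw [smallCube_eq, ((hasFDerivAt_affineEquiv φ _).comp t (hasFDerivAt_gridCube k _ _ t)).fderiv]
  simp [frame, Pi.single_apply]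

theorem integralOver_smallCube (m : Fin n → Fin k) (τ : Face n p) (η : DForm n p) :
    integralOver (smallCube φ k m τ) η =
      (k : ℝ)⁻¹ ^ p * cubeMean k τ.dir (gridIndex m τ) (cellCoeff φ τ.dir η) := by
  unfold integralOver cubeMean
  simp_rw [fderiv_smallCube]
  rw [← integral_const_mul]
  refine integral_congr_ae (Filter.Eventually.of_forall fun t => ?_)
  dsimp only
  rw [smallCube_eq, Function.comp_apply]
  have hsmul := (η (φ (gridCube k τ.dir (gridIndex m τ) t))).toMultilinearMap.map_smul_univ
    (fun _ => (k : ℝ)⁻¹) (frame φ τ.dir)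
  simpa [cellCoeff_apply] using hsmul

/-- The grids of different directions and the coefficients in the frame decouple the problem into
one scalar interpolation problem for each `I`. -/
theorem existsUnique_mem_cellSpace (hk : 1 ≤ k) (Y : ((Fin p → ℝ) → ℝ^n) → ℝ) :
    ∃! η : DForm n p, η ∈ cellSpace φ k p ∧ ∀ (m : Fin n → Fin k) (τ : Face n p),
      integralOver (smallCube φ k m τ) η = Y (smallCube φ k m τ) := by
  have hk' : (k : ℝ) ^ p ≠ 0 := by positivity
  choose f hf hf_unique using fun I : Fin p ↪o Fin n => (cubeMeans_bijective hk I).existsUnique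
    fun a => (k : ℝ) ^ p * Y (φ ∘ gridCube k I a)
  have hiff (η : DForm n p) (m : Fin n → Fin k) (τ : Face n p) :
      integralOver (smallCube φ k m τ) η = Y (smallCube φ k m τ) ↔
        cubeMean k τ.dir (gridIndex m τ) (cellCoeff φ τ.dir η) =
          (k : ℝ) ^ p * Y (φ ∘ gridCube k τ.dir (gridIndex m τ)) := by
    rw [integralOver_smallCube, smallCube_eq, inv_pow, inv_mul_eq_iff_eq_mul₀ hk']
  simp_rw [hiff]
  refine ⟨∑ I, cellForm φ I (f I), ⟨(mem_cellSpace_iff φ hk).2 fun I => ?_, fun m τ => ?_⟩, ?_⟩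
  · rw [cellCoeff_sum_cellForm φ I fun J => (f J).1]
    exact (f I).2
  · rw [cellCoeff_sum_cellForm φ τ.dir fun J => (f J).1]
    exact congrFun (hf τ.dir) ⟨_, Finset.mem_Iic.2 (gridIndex_le_coeffDegree m τ)⟩
  · rintro η ⟨hη, hmean⟩
    rw [← sum_cellForm_cellCoeff φ η]
    refine Finset.sum_congr rfl fun I _ => congrArg (cellForm φ I) ?_
    refine congrArg Subtype.val (hf_unique I ⟨_, (mem_cellSpace_iff φ hk).1 hη I⟩
      (funext fun a => ?_))
    obtain ⟨m, τ, rfl, ha⟩ := exists_gridIndex_eq hk (Finset.mem_Iic.1 a.2)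
    change cubeMean k τ.dir a (cellCoeff φ τ.dir η) = _
    rw [← ha]
    exact hmean m τ

end Integrals

section Mesh

variable {Ω : Set (ℝ^n)} {k : ℕ}

theorem CubicalMesh.existsUnique_isInterpolant (K : CubicalMesh n Ω) (hk : 1 ≤ k)
    (X : K.smallCubes k p → ℝ) : ∃! η, K.IsInterpolant k X η := by
  choose η hη hη_unique using fun σ : K.cells =>
    existsUnique_mem_cellSpace (K.chart σ) hk (Function.extend Subtype.val X 0)
  have hX (σ : K.cells) (m : Fin n → Fin k) (τ : Face n p) :
      Function.extend Subtype.val X 0 (smallCube (K.chart σ) k m τ) =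
        X ⟨smallCube (K.chart σ) k m τ, σ, m, τ, rfl⟩ :=
    Subtype.val_injective.extend_apply X 0 ⟨_, σ, m, τ, rfl⟩
  simp_rw [hX] at hη hη_unique
  exact ⟨η, hη, fun η' hη' => funext fun σ => hη_unique σ _ (hη' σ)⟩

theorem CubicalMesh.isInterpolant_interpolate (K : CubicalMesh n Ω) (hk : 1 ≤ k)
    (X : K.smallCubes k p → ℝ) : K.IsInterpolant k X (K.interpolate k X) :=
  Classical.epsilon_spec (K.existsUnique_isInterpolant hk X).exists

end Mesh

section ErrorBound

variable (φ : ℝ^n ≃ᵃ[ℝ] ℝ^n) {k : ℕ}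

theorem contDiff_affineEquiv {r : WithTop ℕ∞} : ContDiff ℝ r φ := by
  rw [show ⇑φ = fun x => linearPart φ x + φ 0 from funext (map_eq_linearPart_add φ)]
  exact (linearPart φ).contDiff.add contDiff_const

theorem iteratedFDeriv_comp_affineEquiv {F : Type*} [NormedAddCommGroup F] [NormedSpace ℝ F]
    (f : ℝ^n → F) (j : ℕ) (x : ℝ^n) : iteratedFDeriv ℝ j (f ∘ φ) x =
      (iteratedFDeriv ℝ j f (φ x)).compContinuousLinearMap
        fun _ => (linearPart φ : ℝ^n →L[ℝ] ℝ^n) := by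
  have hlinear := (linearPart φ).iteratedFDerivWithin_comp_right (fun y => f (y + φ 0))
    uniqueDiffOn_univ (mem_univ (linearPart φ x)) j
  rw [preimage_univ, iteratedFDerivWithin_univ, iteratedFDerivWithin_univ,
    iteratedFDeriv_comp_add_right, ← map_eq_linearPart_add] at hlinear
  rw [← hlinear]
  congr 1
  exact funext fun y => congrArg f (map_eq_linearPart_add φ y)

theorem cellCoeff_eq_comp (I : Fin p ↪o Fin n) (ω : DForm n p) :
    cellCoeff φ I ω = ContinuousAlternatingMap.apply ℝ (ℝ^n) ℝ (frame φ I) ∘ (ω ∘ φ) := rfl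

theorem contDiffAt_cellCoeff (I : Fin p ↪o Fin n) {ω : DForm n p} {x : ℝ^n} {r : WithTop ℕ∞}
    (hω : ContDiffAt ℝ r ω (φ x)) : ContDiffAt ℝ r (cellCoeff φ I ω) x := by
  rw [cellCoeff_eq_comp]
  exact (hω.comp x (contDiff_affineEquiv φ).contDiffAt).continuousLinearMap_comp _

theorem iteratedFDeriv_cellCoeff (I : Fin p ↪o Fin n) {ω : DForm n p} {x : ℝ^n}
    (hω : ContDiffAt ℝ k ω (φ x)) (v : Fin k → ℝ^n) :
    iteratedFDeriv ℝ k (cellCoeff φ I ω) x v =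
      iteratedFDeriv ℝ k ω (φ x) (fun j => linearPart φ (v j)) (frame φ I) := by
  rw [cellCoeff_eq_comp, ContinuousLinearMap.iteratedFDeriv_comp_left _
    (hω.comp x (contDiff_affineEquiv φ).contDiffAt) le_rfl, iteratedFDeriv_comp_affineEquiv]
  rfl

theorem abs_iteratedFDeriv_cellCoeff_le (I : Fin p ↪o Fin n) {ω : DForm n p} {x v : ℝ^n}
    (hω : ContDiffAt ℝ k ω (φ x)) (hv : v ∈ unitCube n) :
    |iteratedFDeriv ℝ k (cellCoeff φ I ω) x fun _ => v| ≤ ‖iteratedFDeriv ℝ k ω (φ x)‖ *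
      Metric.diam (φ '' unitCube n) ^ k * Metric.diam (φ '' unitCube n) ^ p := by
  set d := Metric.diam (φ '' unitCube n)
  have hlinear : ‖linearPart φ v‖ ≤ d := by
    simpa only [sub_zero] using norm_linearPart_sub_le φ hv zero_mem_unitCube
  have hframe : ∏ j, ‖frame φ I j‖ ≤ d ^ p :=
    (Finset.prod_le_prod (g := fun _ => d) (fun _ _ => norm_nonneg _)
      fun j _ => norm_linearPart_stdVec_le φ (I j)).trans (by simp)
  have hderiv : ‖iteratedFDeriv ℝ k ω (φ x) fun _ => linearPart φ v‖ ≤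
      ‖iteratedFDeriv ℝ k ω (φ x)‖ * d ^ k :=
    ContinuousMultilinearMap.le_opNorm_mul_pow_of_le _
      ((pi_norm_le_iff_of_nonneg Metric.diam_nonneg).2 fun _ => hlinear)
  rw [iteratedFDeriv_cellCoeff φ I hω, ← Real.norm_eq_abs]
  exact (ContinuousAlternatingMap.le_opNorm _ _).trans
    (mul_le_mul hderiv hframe (by positivity) (by positivity))

theorem cubeMean_cellCoeff_eq_of_integralOver_eq (hk : 1 ≤ k) {η ω : DForm n p}
    (h : ∀ (m : Fin n → Fin k) (τ : Face n p),
      integralOver (smallCube φ k m τ) η = integralOver (smallCube φ k m τ) ω)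
    {I : Fin p ↪o Fin n} {a : Fin n → ℕ} (ha : a ≤ coeffDegree k I) :
    cubeMean k I a (cellCoeff φ I η) = cubeMean k I a (cellCoeff φ I ω) := by
  obtain ⟨m, τ, rfl, rfl⟩ := exists_gridIndex_eq hk ha
  simpa only [integralOver_smallCube, mul_right_inj' (a := (k : ℝ)⁻¹ ^ p) (by positivity)]
    using h m τ

theorem exists_norm_sub_le_of_integralOver_eq (n p : ℕ) (hk : 1 ≤ k) : ∃ C : ℝ, 0 ≤ C ∧
    ∀ (φ : ℝ^n ≃ᵃ[ℝ] ℝ^n) (ω : DForm n p) (M : ℝ),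
      (∀ x ∈ φ '' unitCube n, ContDiffAt ℝ k ω x) →
      (∀ x ∈ φ '' unitCube n, ‖iteratedFDeriv ℝ k ω x‖ ≤ M) →
      ∀ η ∈ cellSpace φ k p, (∀ (m : Fin n → Fin k) (τ : Face n p),
        integralOver (smallCube φ k m τ) η = integralOver (smallCube φ k m τ) ω) →
      ∀ x ∈ φ '' unitCube n, ‖η x - ω x‖ ≤
        C * M / fullness (φ '' unitCube n) ^ p * Metric.diam (φ '' unitCube n) ^ k := by
  choose C hC hcoeff using fun I : Fin p ↪o Fin n => exists_abs_sub_le_of_cubeMean_eq hk I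
  refine ⟨(∑ I, C I * ‖(dx I : ℝ^n [⋀^Fin p]→L[ℝ] ℝ)‖) * n ^ p,
    mul_nonneg (Finset.sum_nonneg fun I _ => mul_nonneg (hC I) (norm_nonneg _)) (by positivity), ?_⟩
  rintro φ ω M hω hM η hη hint _ ⟨x, hx, rfl⟩
  set d := Metric.diam (φ '' unitCube n)
  have hM0 : 0 ≤ M := (norm_nonneg _).trans (hM _ (mem_image_of_mem φ hx))
  have herror (I : Fin p ↪o Fin n) :
      |(η (φ x) - ω (φ x)) (frame φ I)| ≤ C I * (M * d ^ k * d ^ p) :=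
    hcoeff I _ ((mem_cellSpace_iff φ hk).1 hη I) _
      (fun z hz => contDiffAt_cellCoeff φ I (hω _ (mem_image_of_mem φ hz)))
      (fun a ha => cubeMean_cellCoeff_eq_of_integralOver_eq φ hk hint ha) _
      (fun z hz v hv => (abs_iteratedFDeriv_cellCoeff_le φ I
        (hω _ (mem_image_of_mem φ hz)) hv).trans (by gcongr; exact hM _ (mem_image_of_mem φ hz)))
      x hx
  calc ‖η (φ x) - ω (φ x)‖
      ≤ ∑ I : Fin p ↪o Fin n, |(η (φ x) - ω (φ x)) (frame φ I)| *
          (‖(dx I : ℝ^n [⋀^Fin p]→L[ℝ] ℝ)‖ * ‖((linearPart φ).symm : ℝ^n →L[ℝ] ℝ^n)‖ ^ p) :=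
        norm_le_sum_apply_frame φ _
    _ ≤ ∑ I : Fin p ↪o Fin n, C I * (M * d ^ k * d ^ p) *
          (‖(dx I : ℝ^n [⋀^Fin p]→L[ℝ] ℝ)‖ * ‖((linearPart φ).symm : ℝ^n →L[ℝ] ℝ^n)‖ ^ p) := by
        gcongr with I
        exact herror I
    _ = (∑ I, C I * ‖(dx I : ℝ^n [⋀^Fin p]→L[ℝ] ℝ)‖) * M * d ^ k *
          (d * ‖((linearPart φ).symm : ℝ^n →L[ℝ] ℝ^n)‖) ^ p := by
        simp_rw [Finset.sum_mul]
        exact Finset.sum_congr rfl fun I _ => by ring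
    _ ≤ (∑ I, C I * ‖(dx I : ℝ^n [⋀^Fin p]→L[ℝ] ℝ)‖) * M * d ^ k *
          (n / fullness (φ '' unitCube n)) ^ p := by
        have hsum := Finset.sum_nonneg fun (I : Fin p ↪o Fin n) (_ : I ∈ Finset.univ) =>
          mul_nonneg (hC I) (norm_nonneg (dx I : ℝ^n [⋀^Fin p]→L[ℝ] ℝ))
        gcongr
        exact diam_mul_norm_linearPart_symm_le φ
    _ = _ := by ring

end ErrorBound

end CubicalForms

theorem mainTheorem4_general (n p k : ℕ) (hk : 1 ≤ k) :
    ∃ C : ℝ, ∀ (Ω : Set (EuclideanSpace ℝ (Fin n))) (ω : DForm n p) (M : ℝ),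
      (∀ x ∈ Ω, ContDiffAt ℝ k ω x) → (∀ x ∈ Ω, ‖iteratedFDeriv ℝ k ω x‖ ≤ M) →
      ∀ (h CΘ : ℝ), 0 < CΘ → ∀ K : CubicalForms.CubicalMesh n Ω,
        (∀ σ ∈ K.cells, Metric.diam σ ≤ h ∧ CΘ ≤ CubicalForms.fullness σ) →
        (∃! η, K.IsInterpolant k (K.deRham k ω) η) ∧
        ∀ (σ : K.cells), ∀ x ∈ (σ : Set (EuclideanSpace ℝ (Fin n))),
          ‖K.interpolate k (K.deRham k ω) σ x - ω x‖ ≤ C * M / CΘ ^ p * h ^ k := by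
  obtain ⟨C, hC, herror⟩ := CubicalForms.exists_norm_sub_le_of_integralOver_eq n p hk
  refine ⟨C, fun Ω ω M hω hM h CΘ hCΘ K hK =>
    ⟨K.existsUnique_isInterpolant hk _, fun σ x hx => ?_⟩⟩
  have hM0 : 0 ≤ M := (norm_nonneg _).trans (hM x (K.subset σ hx))
  obtain ⟨hmem, hint⟩ := K.isInterpolant_interpolate hk (K.deRham k ω) σ
  have hcell := herror (K.chart σ) ω M
  rw [K.chart_image σ] at hcell
  obtain ⟨hdiam, hfull⟩ := hK σ σ.2
  calc ‖K.interpolate k (K.deRham k ω) σ x - ω x‖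
      ≤ C * M / CubicalForms.fullness (σ : Set (EuclideanSpace ℝ (Fin n))) ^ p *
          Metric.diam (σ : Set (EuclideanSpace ℝ (Fin n))) ^ k :=
        hcell (fun y hy => hω y (K.subset σ hy)) (fun y hy => hM y (K.subset σ hy)) _ hmem hint x hx
    _ ≤ C * M / CΘ ^ p * h ^ k := by gcongr

theorem mainTheorem4 (n p k : ℕ) (hk : 1 ≤ k)
    (Ω U : Set (EuclideanSpace ℝ (Fin n))) (hU : IsOpen U) (hΩU : Ω ⊆ U)
    (ω : DForm n p) (hω : ContDiffOn ℝ (⊤ : ℕ∞) ω U)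
    (hbound : ∃ M : ℝ, ∀ x ∈ Ω, ‖iteratedFDeriv ℝ k ω x‖ ≤ M) :
    ∃ C : ℝ, ∀ (h CΘ : ℝ), 0 < h → 0 < CΘ → ∀ K : CubicalForms.CubicalMesh n Ω,
      (∀ σ ∈ K.cells, Metric.diam σ ≤ h ∧ CΘ ≤ CubicalForms.fullness σ) →
        (∃! η, K.IsInterpolant k (K.deRham k ω) η) ∧
        ∀ (σ : K.cells), ∀ x ∈ (σ : Set (EuclideanSpace ℝ (Fin n))),
          ‖K.interpolate k (K.deRham k ω) σ x - ω x‖ ≤ C / CΘ ^ p * h ^ k := by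
  obtain ⟨M, hM⟩ := hbound
  obtain ⟨C, hC⟩ := mainTheorem4_general n p k hk
  exact ⟨C * M, fun h CΘ _ => hC Ω ω M
    (fun x hx => (hω.contDiffAt (hU.mem_nhds (hΩU hx))).of_le (by exact_mod_cast le_top)) hM h CΘ⟩
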